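/- **Conventions.** Let $A$ be a von Neumann algebra and $h:A\to A$ a $*$-automorphism. Let $\mathcal C$ be the poset, ordered by inclusion, of abelian von Neumann subalgebras $C\subseteq A$ that contain the unit of $A$, and let $\hat h:\mathcal C\to\mathcal C$, $C\mapsto h[C]$. For self-adjoint $a\in A$ and $x\in\mathbb R$ let $e^a_x=\chi_{(-\infty,x]}(a)$ be the spectral resolution of $a$; the spectral order on $A_{sa}$ is defined by $a\le_s b$ iff $e^a_x\ge e^b_x$ for all $x\in\mathbb R$. For $C\in\mathcal C$ the outer and inner daseinisations of $a$ are $$\delta^o(a)_C=\bigwedge\{b\in C_{sa}\mid a\le_s b\},\qquad \delta^i(a)_C=\bigvee\{b\in C_{sa}\mid b\le_s a\},$$ with meet and join taken in $C_{sa}$. A topological space internal to $[\mathcal C^{op},\mathbf{Set}]$ is a presheaf $\underline X$ together with a topology on $\coprod_{C}\underline X(C)$ whose open sets are closed under restriction and for which the projection to $\mathcal C$, with the topology of down-closed sets, is continuous. A continuous map is a natural transformation that induces a continuous map of total spaces. The following internal spaces are used. * $\underline\Sigma$ is the presheaf $C\mapsto\Sigma_C$ (the Gelfand spectrum of $C$)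 with restriction of characters. A subset $U$ of its total space is open iff it is closed under restriction and $U\cap\Sigma_C$ is open in $\Sigma_C$ for every $C$. * $\underline{\mathbb R}_l$ is the presheaf of order-reversing functions $s:{\downarrow}C\to\mathbb R$, with the topology generated by the sets $\{(D,s)\mid D\subseteq C,\ s(D)>x\}$ for $C\in\mathcal C$, $x\in\mathbb R$. * $\underline{\mathbb R}_u$ is the presheaf of order-preserving functions $s:{\downarrow}C\to\mathbb R$, with the topology generated by the sets $\{(D,s)\mid D\subseteq C,\ s(D)<x\}$ for $C\in\mathcal C$, $x\in\mathbb R$. * $H^*$ is the inverse image functor of $\hat h$: $(H^*\underline X)(C)=\underline X(h[C])$, with total space the pullback along $\hat h$ of the total space of $\underline X$, carrying the pullback topology. The following continuous maps are used, where $C\in\mathcal C$, $\lambda$ is a character and $D\subseteq C$. * $\underline{\delta^o(a)}:\underline\Sigma\to\underline{\mathbb R}_l$ and $\underline{\delta^i(a)}:\underline\Sigma\to\underline{\mathbb R}_u$, given for $\lambda\in\Sigma_C$ by $\underline{\delta^o(a)}_C(\lambda)(D)=\lambda(\delta^o(a)_D)$ and $\underline{\delta^i(a)}_C(\lambda)(D)=\lambda(\delta^i(a)_D)$.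 * $\underline\Sigma(h):H^*\underline\Sigma\to\underline\Sigma$, with components $\Sigma_{h[C]}\to\Sigma_C$, $\lambda\mapsto\lambda\circ h|_C$. * $\underline{\mathbb R}_l(h):H^*\underline{\mathbb R}_l\to\underline{\mathbb R}_l$ and $\underline{\mathbb R}_u(h):H^*\underline{\mathbb R}_u\to\underline{\mathbb R}_u$, with components $s\mapsto s\circ\hat h|_{\downarrow C}$. **Proposition.** For every $*$-automorphism $h$ of $A$ and every self-adjoint $a\in A$, the following equalities of continuous maps of internal spaces hold: $$\underline{\mathbb R}_l(h)\circ H^*\big(\underline{\delta^o(h(a))}\big)=\underline{\delta^o(a)}\circ\underline\Sigma(h):H^*\underline\Sigma\to\underline{\mathbb R}_l,$$ $$\underline{\mathbb R}_u(h)\circ H^*\big(\underline{\delta^i(h(a))}\big)=\underline{\delta^i(a)}\circ\underline\Sigma(h):H^*\underline\Sigma\to\underline{\mathbb R}_u.$$ -/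

import Mathlib

universe u

namespace Daseinisation

open Complex CategoryTheory Opposite Topology

set_option linter.unusedSectionVars false

/-! ## Weak-* topology, order intervals, spectral resolutions -/

section WStar

variable {A : Type u} [CStarAlgebra A]

/-- A subset of `A` is weak-* closed (that is, σ-weakly closed) if it is closed in the weak-* topology
that `A` inherits from an identification `φ` of `A` with the dual of a Banach space `X`. The predual
of a von Neumann algebra is unique, so it is immaterial which predual is used; here all of them
are. -/
def IsWeakStarClosed (S : Set A) : Prop :=
  ∀ (X : Type u) [NormedAddCommGroup X] [NormedSpace ℂ X] [CompleteSpace X]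
    (φ : StrongDual ℂ X ≃ₗᵢ⋆[ℂ] A),
    IsClosed {f : WeakDual ℂ X | φ (WeakDual.toStrongDual f) ∈ S}

theorem IsWeakStarClosed.isClosed [WStarAlgebra A] {S : Set A} (h : IsWeakStarClosed S) : IsClosed S := by
  obtain ⟨X, i1, i2, i3, ⟨φ⟩⟩ := WStarAlgebra.exists_predual (M := A)
  have h1 := (h X φ).preimage NormedSpace.Dual.toWeakDual_continuous
  have h2 : IsClosed (φ ⁻¹' S) := h1
  have h3 := h2.preimage φ.symm.continuous
  rw [← Set.preimage_comp] at h3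
  convert h3
  ext x; simp
theorem isSelfAdjoint_of_norm_le {x : A} {c : ℝ}
    (h : ∀ t : ℝ, ‖x + algebraMap ℂ A (t * I)‖ ≤ √(c ^ 2 + t ^ 2)) : IsSelfAdjoint x := by
  have key : ∀ t : ℝ, ‖(imaginaryPart x : A) + algebraMap ℝ A t‖ ≤ √(c ^ 2 + t ^ 2) := by
    intro t
    have h1 : ((imaginaryPart (x + algebraMap ℂ A (t * I)) : selfAdjoint A) : A) =
        (imaginaryPart x : A) + algebraMap ℝ A t := by
      have : algebraMap ℂ A (t * I) = I • (algebraMap ℝ A t) := by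
        rw [Algebra.algebraMap_eq_smul_one, Algebra.algebraMap_eq_smul_one, mul_comm,
          mul_smul, Complex.coe_smul]
      have hsa : IsSelfAdjoint (algebraMap ℝ A t) := by
        exact IsSelfAdjoint.algebraMap A (IsSelfAdjoint.all t)
      rw [map_add, this, imaginaryPart_I_smul, AddSubgroup.coe_add]
      congr 1
      exact hsa.coe_realPart
    rw [← h1]
    exact (imaginaryPart.norm_le _).trans (h t)
  have h0 : (imaginaryPart x : A) = 0 := by
    refine CFC.eq_zero_of_spectrum_subset_zero (R := ℝ) _ ?_ (imaginaryPart x).2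
    intro β hβ
    by_contra hne
    have hne : β ≠ 0 := hne
    have hb : ∀ t : ℝ, (β + t) ^ 2 ≤ c ^ 2 + t ^ 2 := by
      intro t
      have : Nontrivial A := by
        by_contra hA
        rw [not_nontrivial_iff_subsingleton] at hA
        simp at hβ
      have h2 : β + t ∈ spectrum ℝ ((imaginaryPart x : A) + algebraMap ℝ A t) := by
        rw [add_comm (imaginaryPart x : A), spectrum.add_mem_add_iff]
        exact hβ
      have h3 : |β + t| ≤ √(c ^ 2 + t ^ 2) := by
        have := spectrum.norm_le_norm_of_mem h2
        exact this.trans (key t)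
      have h4 := pow_le_pow_left₀ (abs_nonneg _) h3 2
      rwa [sq_abs, Real.sq_sqrt (by positivity)] at h4
    have := hb ((c ^ 2 + 1) / (2 * β))
    have e1 : β * ((c ^ 2 + 1) / (2 * β)) = (c ^ 2 + 1) / 2 := by field_simp
    nlinarith [sq_nonneg β, this, mul_self_pos.2 hne, e1]
  have := realPart_add_I_smul_imaginaryPart x
  rw [h0, smul_zero, add_zero] at this
  rw [← this]
  exact (realPart x).2

variable [PartialOrder A] [StarOrderedRing A]

theorem mem_Icc_iff_norm {w : A} {R : ℝ} (hR : 0 ≤ R) :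
    w ∈ Set.Icc 0 (algebraMap ℝ A R) ↔
      ∀ t : ℝ, ‖w - algebraMap ℝ A (R / 2) + algebraMap ℂ A (t * I)‖ ≤ √((R / 2) ^ 2 + t ^ 2) := by
  have e : algebraMap ℝ A R = algebraMap ℝ A (R / 2) + algebraMap ℝ A (R / 2) := by
    rw [← map_add]; congr 1; ring
  constructor
  · intro hw t
    have hsa : IsSelfAdjoint (w - algebraMap ℝ A (R / 2)) :=
      (IsSelfAdjoint.of_nonneg hw.1).sub (IsSelfAdjoint.algebraMap A (IsSelfAdjoint.all _))
    set v := w - algebraMap ℝ A (R / 2) with hv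
    set ρ : A := algebraMap ℝ A (R / 2) with hρ
    have h1 : 0 ≤ ρ - v := by
      rw [hv, sub_nonneg, sub_le_iff_le_add, ← e]; exact hw.2
    have h2 : 0 ≤ ρ + v := by rw [hv]; simpa using hw.1
    have hc : Commute ρ v := Algebra.commutes _ _
    have h3 : 0 ≤ (ρ - v) * (ρ + v) :=
      Commute.mul_nonneg h1 h2 (((Commute.refl ρ).sub_left hc.symm).add_right
        (hc.sub_left (Commute.refl v)))
    have h4 : (ρ - v) * (ρ + v) = algebraMap ℝ A ((R / 2) ^ 2) - v * v := by
      rw [map_pow, ← hρ, sq, sub_mul, mul_add, mul_add, hc.eq]; abel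
    rw [h4, sub_nonneg] at h3
    refine Real.le_sqrt_of_sq_le ?_
    rw [sq ‖_‖, ← CStarRing.norm_star_mul_self]
    have h5 : star (v + algebraMap ℂ A (t * I)) * (v + algebraMap ℂ A (t * I)) =
        v * v + algebraMap ℝ A (t ^ 2) := by
      have hcc : Commute (algebraMap ℂ A (t * I)) v := Algebra.commutes _ _
      have hst : star (algebraMap ℂ A (t * I)) = - algebraMap ℂ A (t * I) := by
        rw [← algebraMap_star_comm, ← map_neg]; congr 1; simp
      have hsq : algebraMap ℝ A (t ^ 2) = - (algebraMap ℂ A (t * I) * algebraMap ℂ A (t * I)) := by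
        rw [← map_mul, ← map_neg, IsScalarTower.algebraMap_apply ℝ ℂ A]
        congr 1
        rw [mul_mul_mul_comm, I_mul_I]
        simp [sq]
      rw [star_add, hsa.star_eq, hst, add_mul, mul_add, mul_add, hsq, ← hcc.eq, neg_mul, neg_mul]
      abel
    rw [h5]
    have h6 : 0 ≤ v * v := by
      have := star_mul_self_nonneg v
      rwa [hsa.star_eq] at this
    have h7 : 0 ≤ algebraMap ℝ A (t ^ 2) := algebraMap_nonneg A (by positivity)
    rw [CStarAlgebra.norm_le_iff_le_algebraMap _ (by positivity) (add_nonneg h6 h7), map_add]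
    gcongr
  · intro h
    have hsa := isSelfAdjoint_of_norm_le h
    have hn : ‖w - algebraMap ℝ A (R / 2)‖ ≤ R / 2 := by
      have := h 0
      simpa [Real.sqrt_sq (by positivity : 0 ≤ R / 2)] using this
    have h1 := hsa.le_algebraMap_norm_self
    have h2 := hsa.neg_algebraMap_norm_le_self
    have h3 : algebraMap ℝ A ‖w - algebraMap ℝ A (R / 2)‖ ≤ algebraMap ℝ A (R / 2) :=
      algebraMap_mono A hn
    constructor
    · have := (neg_le_neg h3).trans h2
      simpa using this
    · have := h1.trans h3
      rw [e]
      simpa [sub_le_iff_le_add] using this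

theorem mem_Icc_iff_both {s y x : A} (hs : IsSelfAdjoint s) (hy : IsSelfAdjoint y) :
    x ∈ Set.Icc s y ↔ x - s ∈ Set.Icc 0 (algebraMap ℝ A ‖y - s‖) ∧
      y - x ∈ Set.Icc 0 (algebraMap ℝ A ‖y - s‖) := by
  have h := (hy.sub hs).le_algebraMap_norm_self
  constructor
  · rintro ⟨h1, h2⟩
    exact ⟨⟨sub_nonneg.2 h1, (sub_le_sub_right h2 s).trans h⟩,
      ⟨sub_nonneg.2 h2, (sub_le_sub_left h1 y).trans h⟩⟩
  · rintro ⟨h1, h2⟩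
    exact ⟨sub_nonneg.1 h1.1, sub_nonneg.1 h2.1⟩

theorem isClosed_Icc_weakStar {X : Type u} [NormedAddCommGroup X] [NormedSpace ℂ X]
    (φ : StrongDual ℂ X ≃ₗᵢ⋆[ℂ] A) {s y : A} (hs : IsSelfAdjoint s) (hy : IsSelfAdjoint y) :
    IsClosed {f : WeakDual ℂ X | φ (WeakDual.toStrongDual f) ∈ Set.Icc s y} := by
  have hball : ∀ (c : A) (r : ℝ),
      IsClosed {f : WeakDual ℂ X | ‖φ (WeakDual.toStrongDual f) - c‖ ≤ r} := by
    intro c r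
    convert WeakDual.isClosed_closedBall (𝕜 := ℂ) (φ.symm c) r using 1
    ext f
    simp only [Set.mem_ofPred_eq, Set.mem_preimage, Metric.mem_closedBall, dist_eq_norm]
    rw [← φ.norm_map (_ - _), map_sub, φ.apply_symm_apply]
  simp only [mem_Icc_iff_both hs hy, mem_Icc_iff_norm (norm_nonneg _), Set.ofPred_and,
    Set.ofPred_forall]
  refine IsClosed.inter (isClosed_iInter fun t => ?_) (isClosed_iInter fun t => ?_)
  · convert hball (s + algebraMap ℝ A (‖y - s‖ / 2) - algebraMap ℂ A (t * I)) _ using 5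
    abel
  · convert hball (y - algebraMap ℝ A (‖y - s‖ / 2) + algebraMap ℂ A (t * I)) _ using 4
    rw [← norm_neg]
    congr 1
    abel

theorem isCompact_Icc_weakStar {X : Type u} [NormedAddCommGroup X] [NormedSpace ℂ X]
    (φ : StrongDual ℂ X ≃ₗᵢ⋆[ℂ] A) {s y : A} (hs : IsSelfAdjoint s) (hy : IsSelfAdjoint y) :
    IsCompact {f : WeakDual ℂ X | φ (WeakDual.toStrongDual f) ∈ Set.Icc s y} := by
  refine (WeakDual.isCompact_closedBall (𝕜 := ℂ) (φ.symm s) ‖y - s‖).of_isClosed_subset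
    (isClosed_Icc_weakStar φ hs hy) ?_
  intro f hf
  simp only [Set.mem_preimage, Metric.mem_closedBall, dist_eq_norm]
  rw [← φ.norm_map (_ - _), map_sub, φ.apply_symm_apply]
  have := ((mem_Icc_iff_both hs hy).1 hf).1
  exact (CStarAlgebra.norm_le_iff_le_algebraMap _ (norm_nonneg _) this.1).2 this.2

/-- In a weak-* closed subset, an element between two families of self-adjoint elements exists as
soon as one exists between any two finite subfamilies. -/
theorem exists_between_of_finite [WStarAlgebra A] {C : Set A} (hC : IsWeakStarClosed C)
    {L U : Set A} (hL : ∀ x ∈ L, IsSelfAdjoint x) (hU : ∀ x ∈ U, IsSelfAdjoint x)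
    (hL0 : L.Nonempty) (hU0 : U.Nonempty)
    (h : ∀ F G : Finset A, ↑F ⊆ L → ↑G ⊆ U → F.Nonempty → G.Nonempty →
      ∃ m ∈ C, (∀ x ∈ F, x ≤ m) ∧ ∀ y ∈ G, m ≤ y) :
    ∃ m ∈ C, (∀ x ∈ L, x ≤ m) ∧ ∀ y ∈ U, m ≤ y := by
  classical
  obtain ⟨X, i1, i2, i3, ⟨φ⟩⟩ := WStarAlgebra.exists_predual (M := A)
  have hCc := hC X φ
  obtain ⟨x0, hx0⟩ := hL0
  obtain ⟨y0, hy0⟩ := hU0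
  let K : L × U → Set (WeakDual ℂ X) := fun p =>
    {f | φ (WeakDual.toStrongDual f) ∈ C} ∩
      {f | φ (WeakDual.toStrongDual f) ∈ Set.Icc (p.1 : A) p.2}
  have hK : ∀ p, IsClosed (K p) := fun p =>
    hCc.inter (isClosed_Icc_weakStar φ (hL _ p.1.2) (hU _ p.2.2))
  have hK0 : IsCompact (K (⟨x0, hx0⟩, ⟨y0, hy0⟩)) :=
    (isCompact_Icc_weakStar φ (hL _ hx0) (hU _ hy0)).inter_left hCc
  have hne : ((K (⟨x0, hx0⟩, ⟨y0, hy0⟩)) ∩ ⋂ p, K p).Nonempty := by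
    refine hK0.inter_iInter_nonempty K hK fun T => ?_
    obtain ⟨m, hm, hm1, hm2⟩ := h (insert x0 (T.image fun p => (p.1 : A)))
      (insert y0 (T.image fun p => (p.2 : A))) (by
        intro z hz; simp at hz; rcases hz with rfl | ⟨h1, -⟩ <;> assumption) (by
        intro z hz; simp at hz; rcases hz with rfl | ⟨-, -, h1, -⟩ <;> assumption) (by simp) (by simp)
    refine ⟨WeakDual.toStrongDual.symm (φ.symm m), ⟨by simpa using hm, ?_⟩, ?_⟩
    · have := hm1 x0 (by simp)
      have := hm2 y0 (by simp)
      simp [*]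
    · simp only [Set.mem_iInter]
      intro p hp
      refine ⟨by simpa using hm, ?_⟩
      have h1 := hm1 p.1 (Finset.mem_insert_of_mem (Finset.mem_image_of_mem _ hp))
      have h2 := hm2 p.2 (Finset.mem_insert_of_mem (Finset.mem_image_of_mem _ hp))
      simp [h1, h2]
  obtain ⟨f, -, hf⟩ := hne
  simp only [Set.mem_iInter] at hf
  exact ⟨φ (WeakDual.toStrongDual f), (hf (⟨x0, hx0⟩, ⟨y0, hy0⟩)).1,
    fun x hx => (hf (⟨x, hx⟩, ⟨y0, hy0⟩)).2.1, fun y hy => (hf (⟨x0, hx0⟩, ⟨y, hy⟩)).2.2⟩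

theorem isSelfAdjoint_of_le {x y : A} (hx : IsSelfAdjoint x) (h : x ≤ y) : IsSelfAdjoint y := by
  have := (IsSelfAdjoint.of_nonneg (sub_nonneg.2 h)).add hx
  simpa using this

/-- The function `t ↦ 1 / max(t, 1/(n+1))`; then `t * approxStep n t` is `min(1, (n+1) t)` for `t ≥ 0`. -/
noncomputable def approxStep (n : ℕ) (t : ℝ) : ℝ := (max t (1 / ((n : ℝ) + 1)))⁻¹

theorem approxStep_pos (n : ℕ) (t : ℝ) : 0 < max t (1 / ((n : ℝ) + 1)) :=
  lt_max_of_lt_right (by positivity)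

@[fun_prop]
theorem continuous_approxStep (n : ℕ) : Continuous (approxStep n) := by
  unfold approxStep
  exact (continuous_id.max continuous_const).inv₀ fun t => (approxStep_pos n t).ne'

theorem approxStep_mono {n m : ℕ} (h : n ≤ m) (t : ℝ) : approxStep n t ≤ approxStep m t := by
  unfold approxStep
  refine inv_anti₀ (approxStep_pos m t) (max_le_max le_rfl ?_)
  have : (n : ℝ) ≤ m := by exact_mod_cast h
  gcongr

theorem mul_approxStep_le (n : ℕ) (t : ℝ) : t * approxStep n t ≤ 1 := by
  unfold approxStep
  rw [← div_eq_mul_inv, div_le_one (approxStep_pos n t)]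
  exact le_max_left _ _

theorem mul_one_sub_le (n : ℕ) {t : ℝ} (ht : 0 ≤ t) :
    t * (1 - t * approxStep n t) ≤ 1 / ((n : ℝ) + 1) := by
  have h0 : 0 < 1 / ((n : ℝ) + 1) := by positivity
  rcases le_total (1 / ((n : ℝ) + 1)) t with h | h
  · have : t * approxStep n t = 1 := by
      unfold approxStep
      rw [max_eq_left h, mul_inv_cancel₀ (h0.trans_le h).ne']
    rw [this]; simpa using h0.le
  · have : 0 ≤ approxStep n t := (inv_pos.2 (approxStep_pos n t)).le
    nlinarith [mul_nonneg ht this, mul_nonneg ht (mul_nonneg ht this)]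

/-- An increasing sequence in `n` of elements whose supremum is the support projection of `d ≥ 0`. -/
noncomputable def approxProj (d : A) (n : ℕ) : A := cfc (fun t : ℝ => t * approxStep n t) d

theorem approxProj_eq {d : A} (hd : IsSelfAdjoint d) (n : ℕ) :
    approxProj d n = cfc (approxStep n) d * d := by
  unfold approxProj
  have h := (cfc_commute_cfc (approxStep n) (fun t => t) d).eq
  rw [cfc_id' ℝ d] at h
  rw [cfc_mul (fun t : ℝ => t) (approxStep n) d, cfc_id' ℝ d, h]

theorem isSelfAdjoint_approxProj (d : A) (n : ℕ) : IsSelfAdjoint (approxProj d n) :=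
  cfc_predicate _ _

theorem exists_sup_approxProj [WStarAlgebra A] {d : A} (hd : 0 ≤ d) :
    ∃ r, IsLUB (Set.range (approxProj d)) r := by
  have hsp : ∀ t ∈ spectrum ℝ d, 0 ≤ t := fun t ht => spectrum_nonneg_of_nonneg hd ht
  have hmono : ∀ n m, n ≤ m → approxProj d n ≤ approxProj d m := by
    intro n m h
    refine cfc_mono fun t ht => ?_
    exact mul_le_mul_of_nonneg_left (approxStep_mono h t) (hsp t ht)
  have hsa : ∀ n, IsSelfAdjoint (approxProj d n) := fun n => cfc_predicate _ _
  obtain ⟨r, -, h1, h2⟩ := exists_between_of_finite (C := (Set.univ : Set A))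
    (fun X _ _ _ φ => by simp) (L := Set.range (approxProj d))
    (U := upperBounds (Set.range (approxProj d)))
    (by rintro _ ⟨n, rfl⟩; exact hsa n)
    (fun y hy => isSelfAdjoint_of_le (hsa 0) (hy ⟨0, rfl⟩)) ⟨_, 0, rfl⟩
    ⟨1, by
      rintro _ ⟨n, rfl⟩
      exact cfc_le_one (fun t => t * approxStep n t) d fun t _ => mul_approxStep_le n t⟩ (by
      classical
      intro F G hF hG _ _
      have : ∀ F : Finset A, ↑F ⊆ Set.range (approxProj d) → ∃ n, ∀ x ∈ F, x ≤ approxProj d n := by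
        intro F
        induction F using Finset.induction_on with
        | empty => intro _; exact ⟨0, by simp⟩
        | insert a F ha ih =>
          intro hF
          rw [Finset.coe_insert, Set.insert_subset_iff] at hF
          obtain ⟨n, hn⟩ := ih hF.2
          obtain ⟨k, rfl⟩ := hF.1
          refine ⟨max n k, fun x hx => ?_⟩
          rcases Finset.mem_insert.1 hx with rfl | hx
          · exact hmono _ _ (le_max_right _ _)
          · exact (hn x hx).trans (hmono _ _ (le_max_left _ _))
      obtain ⟨n, hn⟩ := this F hF
      exact ⟨_, trivial, hn, fun y hy => hG hy ⟨n, rfl⟩⟩)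
  exact ⟨r, fun x hx => h1 x hx, fun y hy => h2 y hy⟩

theorem commute_sup_approxProj {d r : A} (hd : 0 ≤ d)
    (hr : IsLUB (Set.range (approxProj d)) r) : Commute r d := by
  have hdsa : IsSelfAdjoint d := .of_nonneg hd
  by_cases h0 : d = 0
  · rw [h0]; exact Commute.zero_right r
  have hn : ‖d‖ ≠ 0 := norm_ne_zero_iff.2 h0
  let d' : selfAdjoint A := ⟨‖d‖⁻¹ • d, (IsSelfAdjoint.all ‖d‖⁻¹).smul hdsa⟩
  have hd' : ‖d'‖ ≤ 1 := by
    change ‖(‖d‖⁻¹ • d : A)‖ ≤ 1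
    rw [norm_smul, norm_inv, norm_norm, inv_mul_cancel₀ hn]
  let u : unitary A := selfAdjoint.unitarySelfAddISMul d' hd'
  have hud : Commute (u : A) d := by
    have h1 : Commute (d' : A) d := (Commute.refl d).smul_left _
    have h2 : Commute (CFC.sqrt (1 - (d' : A) ^ 2)) d := by
      unfold CFC.sqrt
      exact Commute.cfcₙ_nnreal ((Commute.one_left d).sub_left (h1.pow_left 2)) _
    exact h1.add_left (h2.smul_left I)
  have huy : ∀ n, Commute (u : A) (approxProj d n) := fun n =>
    (Commute.cfc_real hud.symm _).symm
  have h1 : ∀ v : unitary A, (∀ n, Commute (v : A) (approxProj d n)) →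
      r ≤ v * r * star (v : A) := by
    intro v hv
    refine hr.2 ?_
    rintro _ ⟨n, rfl⟩
    have := star_right_conjugate_le_conjugate (hr.1 ⟨n, rfl⟩) (v : A)
    rwa [(hv n).eq, mul_assoc, Unitary.mul_star_self_of_mem v.2, mul_one] at this
  have h2 := h1 u huy
  have h3 := h1 (star u) (fun n => by
    have := (huy n).star_star
    rwa [(isSelfAdjoint_approxProj d n).star_eq] at this)
  have h4 := star_right_conjugate_le_conjugate h3 (u : A)
  have h5 : (u : A) * (((star u : unitary A) : A) * r * star ((star u : unitary A) : A)) * star (u : A) = r := by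
    have h6 := Unitary.mul_star_self_of_mem u.2
    simp only [Unitary.coe_star, star_star, mul_assoc]
    rw [h6, mul_one, ← mul_assoc, h6, one_mul]
  rw [h5] at h4
  have h7 : r = u * r * star (u : A) := le_antisymm h2 h4
  have h8 : r * u = u * r := by
    conv_lhs => rw [h7, mul_assoc, Unitary.star_mul_self_of_mem u.2, mul_one]
  have hrsa : IsSelfAdjoint r :=
    isSelfAdjoint_of_le (isSelfAdjoint_approxProj d 0) (hr.1 ⟨0, rfl⟩)
  have h9 : Commute r (u : A) := h8
  have h10 : Commute r (star (u : A)) := by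
    have := h9.star_star
    rwa [hrsa.star_eq] at this
  have h11 : Commute r (d' : A) := by
    have h12 := selfAdjoint.realPart_unitarySelfAddISMul d' hd'
    have h13 : (d' : A) = (2⁻¹ : ℝ) • ((u : A) + star (u : A)) := by
      rw [← h12, realPart_apply_coe]
    rw [h13]
    exact (h9.add_right h10).smul_right _
  have h14 : d = ‖d‖ • (d' : A) := by
    simp [d', smul_smul, hn]
  rw [h14]
  exact h11.smul_right _

theorem isGreatest_one_sub_sup {d r : A} (hd : 0 ≤ d)
    (hr : IsLUB (Set.range (approxProj d)) r) :
    IsGreatest {p : A | IsStarProjection p ∧ d * p = 0} (1 - r) := by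
  have hdsa : IsSelfAdjoint d := .of_nonneg hd
  have hsp : ∀ t ∈ spectrum ℝ d, 0 ≤ t := fun t ht => spectrum_nonneg_of_nonneg hd ht
  have hc := commute_sup_approxProj hd hr
  have hy0 : ∀ n, 0 ≤ approxProj d n := fun n => cfc_nonneg fun t ht =>
    mul_nonneg (hsp t ht) (inv_pos.2 (approxStep_pos n t)).le
  have hr0 : 0 ≤ r := (hy0 0).trans (hr.1 ⟨0, rfl⟩)
  have hr1 : r ≤ 1 := hr.2 (by
    rintro _ ⟨n, rfl⟩
    exact cfc_le_one (fun t => t * approxStep n t) d fun t _ => mul_approxStep_le n t)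
  have hdr : d * (1 - r) = 0 := by
    have h1 : 0 ≤ d * (1 - r) := Commute.mul_nonneg hd (sub_nonneg.2 hr1)
      ((Commute.one_right d).sub_right hc.symm)
    have h2 : ∀ n : ℕ, ‖d * (1 - r)‖ ≤ 1 / ((n : ℝ) + 1) := by
      intro n
      rw [CStarAlgebra.norm_le_iff_le_algebraMap _ (by positivity) h1]
      have h3 : d * (1 - r) ≤ d * (1 - approxProj d n) := by
        rw [← sub_nonneg, ← mul_sub]
        refine Commute.mul_nonneg hd ?_ ?_
        · simpa using hr.1 ⟨n, rfl⟩
        · have : Commute d (approxProj d n) := (Commute.cfc_real (Commute.refl d) _).symm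
          exact ((Commute.one_right d).sub_right this).sub_right
            ((Commute.one_right d).sub_right hc.symm)
      have h4 : d * (1 - approxProj d n) = cfc (fun t : ℝ => t * (1 - t * approxStep n t)) d := by
        rw [cfc_mul (fun t : ℝ => t) (fun t => 1 - t * approxStep n t) d, cfc_id' ℝ d,
          cfc_sub (fun _ => (1 : ℝ)) (fun t => t * approxStep n t) d, cfc_const_one ℝ d]
        rfl
      refine h3.trans ?_
      rw [h4]
      exact cfc_le_algebraMap _ _ d fun t ht => mul_one_sub_le n (hsp t ht)
    have h5 : ‖d * (1 - r)‖ ≤ 0 := ge_of_tendsto' tendsto_one_div_add_atTop_nhds_zero_nat h2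
    exact norm_le_zero_iff.1 h5
  have hdr' : d * r = d := by
    have := hdr
    rw [mul_sub, mul_one, sub_eq_zero] at this
    exact this.symm
  have hyr : ∀ n, approxProj d n * r = approxProj d n := by
    intro n
    rw [approxProj_eq hdsa, mul_assoc, hdr']
  have hidem : r * r = r := by
    refine le_antisymm ?_ ?_
    · have := Commute.mul_nonneg hr0 (sub_nonneg.2 hr1)
        ((Commute.one_right r).sub_right (Commute.refl r))
      rwa [mul_sub, mul_one, sub_nonneg] at this
    · refine hr.2 ?_
      rintro _ ⟨n, rfl⟩
      have hcy : Commute r (approxProj d n) := (Commute.cfc_real hc.symm _).symm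
      have := Commute.mul_nonneg (sub_nonneg.2 (hr.1 ⟨n, rfl⟩)) hr0
        ((Commute.refl r).sub_left hcy.symm)
      rwa [sub_mul, hyr, sub_nonneg] at this
  have hproj : IsStarProjection r := ⟨hidem, .of_nonneg hr0⟩
  refine ⟨⟨hproj.one_sub, hdr⟩, ?_⟩
  rintro p ⟨hp, hdp⟩
  rw [le_sub_comm]
  refine hr.2 ?_
  rintro _ ⟨n, rfl⟩
  have h1 : approxProj d n * p = 0 := by
    rw [approxProj_eq hdsa, mul_assoc, hdp, mul_zero]
  have h2 : p * approxProj d n = 0 := by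
    have := congrArg star h1
    rwa [star_mul, star_zero, hp.isSelfAdjoint.star_eq,
      (isSelfAdjoint_approxProj d n).star_eq] at this
  have h3 : approxProj d n ≤ 1 :=
    cfc_le_one (fun t => t * approxStep n t) d fun t _ => mul_approxStep_le n t
  have h4 := star_left_conjugate_le_conjugate h3 (1 - p)
  have h5 : (1 - p) * (1 - p) = 1 - p := hp.one_sub.isIdempotentElem
  rwa [hp.one_sub.isSelfAdjoint.star_eq, sub_mul 1 p (approxProj d n), h2, one_mul, sub_zero,
    mul_sub, mul_one, h1, sub_zero, mul_one, h5] at h4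

theorem exists_isGreatest_projection [WStarAlgebra A] {d : A} (hd : 0 ≤ d) :
    ∃ p, IsGreatest {p : A | IsStarProjection p ∧ d * p = 0} p := by
  obtain ⟨r, hr⟩ := exists_sup_approxProj hd
  exact ⟨_, isGreatest_one_sub_sup hd hr⟩


/-- The positive part `(a - x)⁺` of `a - x`, through the continuous functional calculus. -/
noncomputable def subPosPart (a : A) (x : ℝ) : A := cfc (fun t : ℝ => max (t - x) 0) a

theorem subPosPart_nonneg (a : A) (x : ℝ) : 0 ≤ subPosPart a x :=
  cfc_nonneg fun _ _ => le_max_right _ _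

/-- The spectral resolution of `a`: `spectralProj a x` is the spectral projection of `a` for the
half-line `(-∞, x]`, that is, the largest projection `p` of `A` with `(a - x)⁺ p = 0`. -/
noncomputable def spectralProj [WStarAlgebra A] (a : A) (x : ℝ) : A :=
  (exists_isGreatest_projection (subPosPart_nonneg a x)).choose

theorem spectralProj_isGreatest [WStarAlgebra A] (a : A) (x : ℝ) :
    IsGreatest {p : A | IsStarProjection p ∧ subPosPart a x * p = 0} (spectralProj a x) :=
  (exists_isGreatest_projection (subPosPart_nonneg a x)).choose_spec

/-- The spectral order `a ≤ₛ b`: the spectral resolutions satisfy `e^b_x ≤ e^a_x` for all real `x`. -/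
def SpectralLE [WStarAlgebra A] (a b : A) : Prop :=
  ∀ x : ℝ, spectralProj b x ≤ spectralProj a x

variable [WStarAlgebra A]

theorem spectrum_abs_le {a : A} {t : ℝ} (ht : t ∈ spectrum ℝ a) : |t| ≤ ‖a‖ := by
  have : Nontrivial A := by
    by_contra hA
    rw [not_nontrivial_iff_subsingleton] at hA
    simp at ht
  exact spectrum.norm_le_norm_of_mem ht

theorem spectralProj_eq_zero {a : A} (ha : IsSelfAdjoint a) {x ε : ℝ} (hε : 0 < ε)
    (h : ∀ t ∈ spectrum ℝ a, x + ε ≤ t) : spectralProj a x = 0 := by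
  have h1 := (spectralProj_isGreatest a x).1.2
  have h2 : cfc (fun t : ℝ => (max (t - x) ε)⁻¹) a * subPosPart a x = 1 := by
    have hcont : Continuous fun t : ℝ => (max (t - x) ε)⁻¹ :=
      ((continuous_id.sub continuous_const).max continuous_const).inv₀ fun t =>
        (lt_max_of_lt_right hε).ne'
    unfold subPosPart
    rw [← cfc_mul _ _ a hcont.continuousOn, ← cfc_const_one ℝ a]
    refine cfc_congr fun t ht => ?_
    have := h t ht
    have h3 : max (t - x) ε = t - x := max_eq_left (by linarith)
    have h4 : max (t - x) 0 = t - x := max_eq_left (by linarith)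
    simp only [h3, h4]
    exact inv_mul_cancel₀ (by linarith)
  calc spectralProj a x = cfc (fun t : ℝ => (max (t - x) ε)⁻¹) a * subPosPart a x *
        spectralProj a x := by rw [h2, one_mul]
    _ = 0 := by rw [mul_assoc, h1, mul_zero]

theorem one_le_spectralProj {a : A} {x : ℝ} (h : ∀ t ∈ spectrum ℝ a, t ≤ x) :
    1 ≤ spectralProj a x := by
  refine (spectralProj_isGreatest a x).2 ⟨.one _, ?_⟩
  have : subPosPart a x = cfc (fun _ : ℝ => (0 : ℝ)) a :=
    cfc_congr fun t ht => max_eq_right (by linarith [h t ht])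
  rw [this, cfc_const_zero, zero_mul]

theorem spectralProj_nonneg (a : A) (x : ℝ) : 0 ≤ spectralProj a x :=
  (spectralProj_isGreatest a x).1.1.nonneg

theorem spectralProj_le_one (a : A) (x : ℝ) : spectralProj a x ≤ 1 :=
  (spectralProj_isGreatest a x).1.1.le_one

theorem mem_spectrum_algebraMap {r t : ℝ} (ht : t ∈ spectrum ℝ (algebraMap ℝ A r)) : t = r := by
  have : Nontrivial A := by
    by_contra hA
    rw [not_nontrivial_iff_subsingleton] at hA
    simp at ht
  rwa [spectrum.scalar_eq, Set.mem_singleton_iff] at ht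

theorem spectralLE_norm (a : A) : SpectralLE a (algebraMap ℝ A ‖a‖) := by
  intro x
  rcases le_or_gt ‖a‖ x with h | h
  · exact (spectralProj_le_one _ _).trans
      (one_le_spectralProj fun t ht => (le_abs_self t).trans ((spectrum_abs_le ht).trans h))
  · rw [spectralProj_eq_zero (IsSelfAdjoint.algebraMap A (IsSelfAdjoint.all _)) (sub_pos.2 h)]
    · exact spectralProj_nonneg _ _
    · intro t ht
      rw [mem_spectrum_algebraMap ht]; simp

theorem neg_norm_spectralLE {a : A} (ha : IsSelfAdjoint a) :
    SpectralLE (algebraMap ℝ A (-‖a‖)) a := by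
  intro x
  rcases le_or_gt (-‖a‖) x with h | h
  · exact (spectralProj_le_one _ _).trans
      (one_le_spectralProj fun t ht => by rw [mem_spectrum_algebraMap ht]; exact h)
  · rw [spectralProj_eq_zero ha (sub_pos.2 h)]
    · exact spectralProj_nonneg _ _
    · intro t ht
      have := (abs_le.1 (spectrum_abs_le ht)).1
      linarith

theorem le_norm_of_spectralLE {a b : A} (hb : IsSelfAdjoint b) (h : SpectralLE b a) :
    b ≤ algebraMap ℝ A ‖a‖ := by
  have h1 : spectralProj b ‖a‖ = 1 := le_antisymm (spectralProj_le_one _ _)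
    ((one_le_spectralProj fun t ht => (le_abs_self t).trans (spectrum_abs_le ht)).trans (h ‖a‖))
  have h2 := (spectralProj_isGreatest b ‖a‖).1.2
  rw [h1, mul_one] at h2
  have h3 : b ≤ algebraMap ℝ A ‖a‖ + subPosPart b ‖a‖ := by
    have h4 : algebraMap ℝ A ‖a‖ + subPosPart b ‖a‖ =
        cfc (fun t : ℝ => ‖a‖ + max (t - ‖a‖) 0) b := by
      rw [cfc_const_add ‖a‖ (fun t : ℝ => max (t - ‖a‖) 0) b]; rfl
    rw [h4]
    conv_lhs => rw [← cfc_id' ℝ b]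
    exact cfc_mono fun t _ => by linarith [le_max_left (t - ‖a‖) 0]
  rwa [h2, add_zero] at h3

theorem neg_norm_le_of_spectralLE {a b : A} (ha : IsSelfAdjoint a) (hb : IsSelfAdjoint b)
    (h : SpectralLE a b) : algebraMap ℝ A (-‖a‖ - 1) ≤ b := by
  set x : ℝ := -‖a‖ - 1 with hx
  have h1 : spectralProj b x = 0 := by
    refine le_antisymm ?_ (spectralProj_nonneg _ _)
    rw [← spectralProj_eq_zero ha (x := x) one_pos]
    · exact h x
    · intro t ht
      have := (abs_le.1 (spectrum_abs_le ht)).1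
      linarith
  obtain ⟨r, hr⟩ := exists_sup_approxProj (subPosPart_nonneg b x)
  have h2 := (spectralProj_isGreatest b x).unique
    (isGreatest_one_sub_sup (subPosPart_nonneg b x) hr)
  rw [h1, eq_comm, sub_eq_zero] at h2
  subst h2
  have hpos : 0 < |x| + ‖b‖ + 1 := by positivity
  have h3 : 1 ≤ cfc (fun t : ℝ => 1 - (|x| + ‖b‖ + 1)⁻¹ * max (x - t) 0) b := by
    refine hr.2 ?_
    rintro _ ⟨n, rfl⟩
    unfold approxProj subPosPart
    rw [← cfc_comp' (fun t : ℝ => t * approxStep n t) (fun t : ℝ => max (t - x) 0) b]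
    refine cfc_mono fun t ht => ?_
    rcases le_total x t with hxt | hxt
    · rw [max_eq_right (by linarith : x - t ≤ 0)]
      simpa using mul_approxStep_le n (max (t - x) 0)
    · rw [max_eq_right (by linarith : t - x ≤ 0), max_eq_left (by linarith : 0 ≤ x - t)]
      rw [zero_mul, sub_nonneg, inv_mul_le_one₀ hpos]
      have := (abs_le.1 (spectrum_abs_le ht)).1
      linarith [le_abs_self x]
  have h4 : cfc (fun t : ℝ => 1 - (|x| + ‖b‖ + 1)⁻¹ * max (x - t) 0) b =
      1 - (|x| + ‖b‖ + 1)⁻¹ • cfc (fun t : ℝ => max (x - t) 0) b := by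
    rw [cfc_sub (fun _ : ℝ => (1 : ℝ)) (fun t => (|x| + ‖b‖ + 1)⁻¹ * max (x - t) 0) b,
      cfc_const_one ℝ b, cfc_const_mul _ (fun t : ℝ => max (x - t) 0) b]
  rw [h4, le_sub_self_iff] at h3
  have h5 : cfc (fun t : ℝ => max (x - t) 0) b ≤ 0 := by
    have := smul_le_smul_of_nonneg_left h3 hpos.le
    rwa [smul_smul, mul_inv_cancel₀ hpos.ne', one_smul, smul_zero] at this
  have h6 : algebraMap ℝ A x ≤ b + cfc (fun t : ℝ => max (x - t) 0) b := by
    have h7 : b + cfc (fun t : ℝ => max (x - t) 0) b =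
        cfc (fun t : ℝ => t + max (x - t) 0) b := by
      rw [cfc_add b (fun t : ℝ => t) (fun t : ℝ => max (x - t) 0), cfc_id' ℝ b]
    rw [h7]
    exact algebraMap_le_cfc _ _ b fun t _ => by linarith [le_max_left (x - t) 0]
  exact h6.trans (by simpa using add_le_add_right h5 b)

theorem exists_inf_two {C : StarSubalgebra ℂ A} (hcl : IsClosed (C : Set A))
    (hcomm : ∀ x ∈ C, ∀ y ∈ C, x * y = y * x) {b c : A} (hb : b ∈ C) (hc : c ∈ C)
    (hbs : IsSelfAdjoint b) (hcs : IsSelfAdjoint c) :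
    ∃ m ∈ C, m ≤ b ∧ m ≤ c ∧ ∀ y, (∀ z ∈ C, Commute y z) → y ≤ b → y ≤ c → y ≤ m := by
  have hds : IsSelfAdjoint (b - c) := hbs.sub hcs
  have hneg : -(b - c) ≤ CFC.abs (b - c) := by
    rw [CFC.abs_eq_cfc_norm (b - c)]
    conv_lhs => rw [← cfc_id' ℝ (b - c), ← cfc_neg]
    exact cfc_mono fun t _ => neg_le_abs t
  have hpos : b - c ≤ CFC.abs (b - c) := by
    rw [CFC.abs_eq_cfc_norm (b - c)]
    conv_lhs => rw [← cfc_id' ℝ (b - c)]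
    exact cfc_mono fun t _ => le_abs_self t
  have hhalf : ∀ z w : A, z + z ≤ w + w → z ≤ w := by
    intro z w h
    have := smul_le_smul_of_nonneg_left h (by norm_num : (0 : ℝ) ≤ 2⁻¹)
    rwa [← two_smul ℝ z, ← two_smul ℝ w, smul_smul, smul_smul,
      inv_mul_cancel₀ (two_ne_zero' ℝ), one_smul, one_smul] at this
  set m : A := (2⁻¹ : ℝ) • (b + c - CFC.abs (b - c)) with hm
  have hmm : m + m = b + c - CFC.abs (b - c) := by
    rw [← two_smul ℝ m, hm, smul_smul, mul_inv_cancel₀ (two_ne_zero' ℝ), one_smul]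
  refine ⟨m, ?_, hhalf _ _ ?_, hhalf _ _ ?_, ?_⟩
  · have h1 : CFC.abs (b - c) ∈ C := by
      rw [CFC.abs_eq_cfc_norm (b - c)]
      have : IsClosed (C : Set A) := hcl
      exact cfc_mem (𝕜 := ℝ) (𝕜' := ℂ) (s := C) _ (sub_mem hb hc)
    rw [hm, ← Complex.coe_smul]
    exact SMulMemClass.smul_mem _ (sub_mem (add_mem hb hc) h1)
  · rw [hmm, sub_le_iff_le_add]
    have := add_le_add_left hneg (b + b)
    have e : -(b - c) + (b + b) = b + c := by abel
    rw [e] at this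
    rwa [add_comm (b + b)]
  · rw [hmm, sub_le_iff_le_add]
    have := add_le_add_left hpos (c + c)
    have e : (b - c) + (c + c) = b + c := by abel
    rw [e] at this
    rwa [add_comm (c + c)]
  · intro y hy hyb hyc
    refine hhalf _ _ ?_
    rw [hmm, le_sub_comm]
    have e : b + c - (y + y) = (b - y) + (c - y) := by abel
    rw [e]
    have h1 := sub_nonneg.2 hyb
    have h2 := sub_nonneg.2 hyc
    set p := b - y with hp
    set q := c - y with hq
    have hbc : Commute b c := hcomm b hb c hc
    have hpq : Commute p q := by
      have := hy b hb
      have := hy c hc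
      exact ((hbc.sub_right (hy b hb).symm).sub_left ((hy c hc).sub_right (Commute.refl y)))
    have e2 : b - c = p - q := by rw [hp, hq]; abel
    have h3 : (b - c) * (b - c) ≤ (p + q) * (p + q) := by
      have h4 : (p + q) * (p + q) - (b - c) * (b - c) = (2 : ℝ) • (2 : ℝ) • (p * q) := by
        clear_value p q
        rw [e2, two_smul ℝ, two_smul ℝ, add_mul, mul_add, mul_add, sub_mul, mul_sub, mul_sub,
          hpq.eq]
        abel
      rw [← sub_nonneg, h4]
      exact smul_nonneg (by norm_num) (smul_nonneg (by norm_num) (Commute.mul_nonneg h1 h2 hpq))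
    have h5 := CFC.sqrt_le_sqrt _ _ h3
    rw [CFC.sqrt_mul_self (p + q) (add_nonneg h1 h2)] at h5
    have h6 : CFC.abs (b - c) = CFC.sqrt ((b - c) * (b - c)) := by
      unfold CFC.abs
      rw [hds.star_eq]
    rwa [h6]


theorem exists_inf_finset {C : StarSubalgebra ℂ A} (hcl : IsClosed (C : Set A))
    (hcomm : ∀ x ∈ C, ∀ y ∈ C, x * y = y * x) (F : Finset A) (hF : F.Nonempty)
    (hFC : ∀ x ∈ F, x ∈ C ∧ IsSelfAdjoint x) :
    ∃ m ∈ C, IsSelfAdjoint m ∧ (∀ x ∈ F, m ≤ x) ∧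
      ∀ y, IsSelfAdjoint y → (∀ z ∈ C, Commute y z) → (∀ x ∈ F, y ≤ x) → y ≤ m := by
  induction hF using Finset.Nonempty.cons_induction with
  | singleton a =>
    have := hFC a (Finset.mem_singleton_self a)
    exact ⟨a, this.1, this.2, by simp, fun y _ _ h => h a (Finset.mem_singleton_self a)⟩
  | cons a F ha hF ih =>
    obtain ⟨m, hm, hms, h1, h2⟩ := ih fun x hx => hFC x (Finset.mem_cons_of_mem hx)
    obtain ⟨ha1, ha2⟩ := hFC a (Finset.mem_cons_self a F)
    obtain ⟨n, hn, hna, hnm, h3⟩ := exists_inf_two hcl hcomm ha1 hm ha2 hms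
    have hns : IsSelfAdjoint n := by
      have := ha2.sub (IsSelfAdjoint.of_nonneg (sub_nonneg.2 hna))
      simpa using this
    refine ⟨n, hn, hns, ?_, ?_⟩
    · intro x hx
      rcases Finset.mem_cons.1 hx with rfl | hx
      · exact hna
      · exact hnm.trans (h1 x hx)
    · intro y hys hyc hy
      exact h3 y hyc (hy a (Finset.mem_cons_self a F))
        (h2 y hys hyc fun x hx => hy x (Finset.mem_cons_of_mem hx))
end WStar

/-! ## Contexts and daseinisation -/

/-- A context of the von Neumann algebra `A`: an abelian von Neumann subalgebra, that is, a commutative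
unital *-subalgebra that is weak-* closed. Contexts are ordered by inclusion. -/
structure Context (A : Type u) [CStarAlgebra A] where
  alg : StarSubalgebra ℂ A
  comm : ∀ x ∈ alg, ∀ y ∈ alg, x * y = y * x
  closed : IsWeakStarClosed (alg : Set A)

namespace Context
variable {A : Type u} [CStarAlgebra A]

theorem alg_injective : Function.Injective (Context.alg (A := A)) := by
  rintro ⟨a, _, _⟩ ⟨b, _, _⟩ h
  cases h
  rfl

instance : PartialOrder (Context A) := PartialOrder.lift Context.alg alg_injective

instance [WStarAlgebra A] (C : Context A) : IsClosed (C.alg : Set A) := C.closed.isClosed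

instance [WStarAlgebra A] (C : Context A) : CompleteSpace C.alg :=
  C.closed.isClosed.completeSpace_coe

/-- The self-adjoint part `C_sa` of a context, with the order inherited from `A`. -/
abbrev SelfAdjoint (C : Context A) : Type u := {b : A // b ∈ C.alg ∧ IsSelfAdjoint b}

variable [PartialOrder A] [StarOrderedRing A] [WStarAlgebra A]

theorem exists_le_between (C : Context A) {S : Set C.SelfAdjoint} (hS : S.Nonempty) {L : Set A}
    (hL0 : L.Nonempty) (hL : ∀ y ∈ L, IsSelfAdjoint y) (hLC : ∀ y ∈ L, ∀ z ∈ C.alg, Commute y z)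
    (hLS : ∀ y ∈ L, ∀ b ∈ S, y ≤ (b : A)) :
    ∃ m : C.SelfAdjoint, (∀ y ∈ L, y ≤ (m : A)) ∧ ∀ b ∈ S, m ≤ b := by
  obtain ⟨b0, hb0⟩ := hS
  obtain ⟨y0, hy0⟩ := hL0
  obtain ⟨m, hm, h1, h2⟩ := exists_between_of_finite C.closed (L := L)
    (U := Subtype.val '' S) hL (by rintro _ ⟨b, -, rfl⟩; exact b.2.2) ⟨y0, hy0⟩
    ⟨_, b0, hb0, rfl⟩ (by
      intro F G hF hG _ hG0
      obtain ⟨m, hm, -, h1, h2⟩ := exists_inf_finset C.closed.isClosed C.comm G hG0 (by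
        intro x hx
        obtain ⟨b, -, rfl⟩ := hG hx
        exact b.2)
      refine ⟨m, hm, fun y hy => h2 y (hL y (hF hy)) (hLC y (hF hy)) fun x hx => ?_, h1⟩
      obtain ⟨b, hb, rfl⟩ := hG hx
      exact hLS y (hF hy) b hb)
  exact ⟨⟨m, hm, isSelfAdjoint_of_le (hL _ hy0) (h1 _ hy0)⟩, h1, fun b hb => h2 b ⟨b, hb, rfl⟩⟩

theorem exists_ge_between (C : Context A) {S : Set C.SelfAdjoint} (hS : S.Nonempty) {U : Set A}
    (hU0 : U.Nonempty) (hU : ∀ y ∈ U, IsSelfAdjoint y) (hUC : ∀ y ∈ U, ∀ z ∈ C.alg, Commute y z)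
    (hUS : ∀ y ∈ U, ∀ b ∈ S, (b : A) ≤ y) :
    ∃ m : C.SelfAdjoint, (∀ y ∈ U, (m : A) ≤ y) ∧ ∀ b ∈ S, b ≤ m := by
  let ν : C.SelfAdjoint → C.SelfAdjoint := fun b => ⟨-b, neg_mem b.2.1, b.2.2.neg⟩
  obtain ⟨m, h1, h2⟩ := C.exists_le_between (S := ν '' S) (hS.image _)
    (L := (fun y => -y) '' U) (hU0.image _) (by rintro _ ⟨y, hy, rfl⟩; exact (hU y hy).neg)
    (by rintro _ ⟨y, hy, rfl⟩ z hz; exact (hUC y hy z hz).neg_left)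
    (by rintro _ ⟨y, hy, rfl⟩ _ ⟨b, hb, rfl⟩; exact neg_le_neg (hUS y hy b hb))
  refine ⟨ν m, fun y hy => neg_le.1 (h1 _ ⟨y, hy, rfl⟩), fun b hb => ?_⟩
  have h3 : (m : A) ≤ -b := h2 _ ⟨b, hb, rfl⟩
  exact le_neg.1 h3

theorem commute_of_le {D C : Context A} (h : D ≤ C) {x z : A} (hx : x ∈ C.alg) (hz : z ∈ D.alg) :
    Commute x z := C.comm x hx z (h hz)

/-- The scalar `r`, as a self-adjoint element of a context. -/
noncomputable def scalar (C : Context A) (r : ℝ) : C.SelfAdjoint :=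
  ⟨algebraMap ℝ A r, by
    rw [IsScalarTower.algebraMap_apply ℝ ℂ A]; exact C.alg.algebraMap_mem _,
    IsSelfAdjoint.algebraMap A (IsSelfAdjoint.all _)⟩

theorem exists_isGLB (C : Context A) {S : Set C.SelfAdjoint} (hS : S.Nonempty) (hb : BddBelow S) :
    ∃ m, IsGLB S m := by
  obtain ⟨y, hy⟩ := hb
  obtain ⟨m, h1, h2⟩ := C.exists_le_between hS (L := Subtype.val '' lowerBounds S)
    ⟨_, y, hy, rfl⟩ (by rintro _ ⟨b, -, rfl⟩; exact b.2.2)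
    (by rintro _ ⟨b, -, rfl⟩ z hz; exact C.comm _ b.2.1 _ hz)
    (by rintro _ ⟨b, hb, rfl⟩ c hc; exact hb hc)
  exact ⟨m, fun b hb => h2 b hb, fun b hb => h1 _ ⟨b, hb, rfl⟩⟩

theorem exists_isLUB (C : Context A) {S : Set C.SelfAdjoint} (hS : S.Nonempty) (hb : BddAbove S) :
    ∃ m, IsLUB S m := by
  obtain ⟨y, hy⟩ := hb
  obtain ⟨m, h1, h2⟩ := C.exists_ge_between hS (U := Subtype.val '' upperBounds S)
    ⟨_, y, hy, rfl⟩ (by rintro _ ⟨b, -, rfl⟩; exact b.2.2)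
    (by rintro _ ⟨b, -, rfl⟩ z hz; exact C.comm _ b.2.1 _ hz)
    (by rintro _ ⟨b, hb, rfl⟩ c hc; exact hb hc)
  exact ⟨m, fun b hb => h2 b hb, fun b hb => h1 _ ⟨b, hb, rfl⟩⟩

theorem exists_outer (C : Context A) {a : A} (ha : IsSelfAdjoint a) :
    ∃ m : C.SelfAdjoint, IsGLB {b : C.SelfAdjoint | SpectralLE a b} m :=
  C.exists_isGLB ⟨C.scalar ‖a‖, spectralLE_norm a⟩
    ⟨C.scalar (-‖a‖ - 1), fun b hb => neg_norm_le_of_spectralLE ha b.2.2 hb⟩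

theorem exists_inner (C : Context A) {a : A} (ha : IsSelfAdjoint a) :
    ∃ m : C.SelfAdjoint, IsLUB {b : C.SelfAdjoint | SpectralLE (b : A) a} m :=
  C.exists_isLUB ⟨C.scalar (-‖a‖), neg_norm_spectralLE ha⟩
    ⟨C.scalar ‖a‖, fun b hb => le_norm_of_spectralLE b.2.2 hb⟩

/-- Outer daseinisation `δᵒ(a)_C`: the greatest lower bound in `C_sa` of `{b ∈ C_sa | a ≤ₛ b}`. -/
noncomputable def outerDas {a : A} (ha : IsSelfAdjoint a) (C : Context A) : C.SelfAdjoint :=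
  (C.exists_outer ha).choose

/-- Inner daseinisation `δⁱ(a)_C`: the least upper bound in `C_sa` of `{b ∈ C_sa | b ≤ₛ a}`. -/
noncomputable def innerDas {a : A} (ha : IsSelfAdjoint a) (C : Context A) : C.SelfAdjoint :=
  (C.exists_inner ha).choose

theorem outerDas_isGLB {a : A} (ha : IsSelfAdjoint a) (C : Context A) :
    IsGLB {b : C.SelfAdjoint | SpectralLE a b} (outerDas ha C) := (C.exists_outer ha).choose_spec

theorem innerDas_isLUB {a : A} (ha : IsSelfAdjoint a) (C : Context A) :
    IsLUB {b : C.SelfAdjoint | SpectralLE (b : A) a} (innerDas ha C) :=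
  (C.exists_inner ha).choose_spec

theorem outerDas_anti {a : A} (ha : IsSelfAdjoint a) {D C : Context A} (h : D ≤ C) :
    (outerDas ha C : A) ≤ outerDas ha D := by
  obtain ⟨m, h1, h2⟩ := D.exists_le_between (S := {b | SpectralLE a b})
    ⟨D.scalar ‖a‖, spectralLE_norm a⟩ (L := {(outerDas ha C : A)}) ⟨_, rfl⟩
    (by rintro _ rfl; exact (outerDas ha C).2.2)
    (by rintro _ rfl z hz; exact commute_of_le h (outerDas ha C).2.1 hz)
    (by
      rintro _ rfl b hb
      exact (outerDas_isGLB ha C).1 (show SpectralLE a (⟨b, h b.2.1, b.2.2⟩ : C.SelfAdjoint) from hb))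
  exact (h1 _ rfl).trans ((outerDas_isGLB ha D).2 fun b hb => h2 b hb)

theorem innerDas_mono {a : A} (ha : IsSelfAdjoint a) {D C : Context A} (h : D ≤ C) :
    (innerDas ha D : A) ≤ innerDas ha C := by
  obtain ⟨m, h1, h2⟩ := D.exists_ge_between (S := {b : D.SelfAdjoint | SpectralLE (b : A) a})
    ⟨D.scalar (-‖a‖), neg_norm_spectralLE ha⟩ (U := {(innerDas ha C : A)}) ⟨_, rfl⟩
    (by rintro _ rfl; exact (innerDas ha C).2.2)
    (by rintro _ rfl z hz; exact commute_of_le h (innerDas ha C).2.1 hz)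
    (by
      rintro _ rfl b hb
      exact (innerDas_isLUB ha C).1
        (show SpectralLE ((⟨b, h b.2.1, b.2.2⟩ : C.SelfAdjoint) : A) a from hb))
  exact LE.le.trans (show (innerDas ha D : A) ≤ m from
    (innerDas_isLUB ha D).2 fun b hb => h2 b hb) (h1 _ rfl)
end Context

/-! ## Internal topological spaces in a presheaf topos over a poset -/

section InternalSpaces

/-- The total space `{(p, x) | p ∈ P, x ∈ F(p)}` of the étale bundle of a presheaf `F` on a poset. -/
abbrev TotalSpace {P : Type u} [Preorder P] (F : Pᵒᵖ ⥤ Type u) : Type u :=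
  Σ p : P, F.obj (op p)

/-- The étale topology on the total space of a presheaf: a set is open if it is closed under
restriction. -/
@[reducible]
def etaleTopology {P : Type u} [Preorder P] (F : Pᵒᵖ ⥤ Type u) :
    TopologicalSpace (TotalSpace F) where
  IsOpen U := ∀ (p q : P) (h : q ≤ p) (x : F.obj (op p)),
    (⟨p, x⟩ : TotalSpace F) ∈ U → (⟨q, F.map (homOfLE h).op x⟩ : TotalSpace F) ∈ U
  isOpen_univ := fun _ _ _ _ _ => trivial
  isOpen_inter := fun _ _ hU hV p q h x hx => ⟨hU p q h x hx.1, hV p q h x hx.2⟩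
  isOpen_sUnion := fun _ hS p q h x ⟨U, hU, hx⟩ => ⟨U, hU, hS U hU p q h x hx⟩

/-- The map of total spaces over `P` induced by a natural transformation. -/
def totalMap {P : Type u} [Preorder P] {F G : Pᵒᵖ ⥤ Type u} (τ : F ⟶ G) :
    TotalSpace F → TotalSpace G :=
  fun z => ⟨z.1, τ.app (op z.1) z.2⟩

/-- A topological space internal to the topos `[Pᵒᵖ, Set]`, in its external description: a presheaf on
`P` together with a topology on its total space that is coarser than the étale topology and for which
the projection to `P`, with the topology of lower sets, is continuous. -/
structure InternalSpace (P : Type u) [Preorder P] where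
  sheaf : Pᵒᵖ ⥤ Type u
  topology : TopologicalSpace (TotalSpace sheaf)
  etale_le : etaleTopology sheaf ≤ topology
  continuous_proj : @Continuous _ _ topology (Topology.lowerSet P) Sigma.fst

namespace InternalSpace

/-- A continuous map of internal spaces: a natural transformation whose map of total spaces is
continuous for the two topologies of the internal spaces. -/
@[ext]
structure Hom {P : Type u} [Preorder P] (X Y : InternalSpace P) where
  toNatTrans : X.sheaf ⟶ Y.sheaf
  continuous : @Continuous _ _ X.topology Y.topology (totalMap toNatTrans)

instance (P : Type u) [Preorder P] : Category (InternalSpace P) where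
  Hom X Y := Hom X Y
  id X := ⟨𝟙 X.sheaf, @continuous_id _ X.topology⟩
  comp {X Y Z} f g := ⟨f.toNatTrans ≫ g.toNatTrans,
    @Continuous.comp _ _ _ X.topology Y.topology Z.topology _ _ g.continuous f.continuous⟩

end InternalSpace

variable {P Q : Type u} [Preorder P] [Preorder Q]

/-- The canonical map from the total space of the pullback of `F` along `f` to that of `F`:
`(p, x) ↦ (f p, x)`. -/
def baseChange (f : P →o Q) (F : Qᵒᵖ ⥤ Type u) :
    TotalSpace (f.monotone.functor.op ⋙ F) → TotalSpace F :=
  fun z => ⟨f z.1, z.2⟩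

/-- The inverse image functor along a monotone map `f : P → Q`. The presheaf is precomposed with `f`;
the total space is the pullback along `f` of the total space of `X`, as a subspace of the product of
`P` (with its topology of lower sets) and the total space of `X`. On maps it is whiskering
with `f`. -/
def inverseImage (f : P →o Q) : InternalSpace Q ⥤ InternalSpace P where
  obj X :=
    { sheaf := f.monotone.functor.op ⋙ X.sheaf
      topology := TopologicalSpace.induced Sigma.fst (Topology.lowerSet P) ⊓
        TopologicalSpace.induced (baseChange f X.sheaf) X.topology
      etale_le := by
        refine le_inf ?_ ?_
        · rintro _ ⟨W, hW, rfl⟩ p q h x hx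
          exact hW h hx
        · rintro _ ⟨W, hW, rfl⟩ p q h x hx
          exact X.etale_le W hW (f p) (f q) (f.monotone h) x hx
      continuous_proj := continuous_iff_le_induced.2 inf_le_left }
  map {X Y} g :=
    { toNatTrans := Functor.whiskerLeft f.monotone.functor.op g.toNatTrans
      continuous := by
        rw [continuous_iff_le_induced, induced_inf, induced_compose, induced_compose]
        refine inf_le_inf le_rfl ?_
        have := continuous_iff_le_induced.1 g.continuous
        refine (induced_mono this).trans ?_
        rw [induced_compose]
        exact le_rfl }


/-- The internal space of lower reals in `[Pᵒᵖ, Set]`: the presheaf of order-reversing functions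
`↓p → ℝ`, with the topology generated by the sets `{(d, s) | d ≤ c, s(d) > x}`. -/
def lowerReals (P : Type u) [Preorder P] : InternalSpace P where
  sheaf :=
    { obj := fun p => {s : Set.Iic p.unop → ℝ // Antitone s}
      map := fun i => TypeCat.ofHom fun s =>
        ⟨fun d => s.1 ⟨d.1, d.2.trans (leOfHom i.unop)⟩, fun _ _ h => s.2 h⟩ }
  topology := TopologicalSpace.generateFrom
    {U | ∃ (c : P) (x : ℝ), U = {z | z.1 ≤ c ∧ x < z.2.1 ⟨z.1, le_rfl⟩ }}
  etale_le := by
    refine le_generateFrom ?_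
    rintro _ ⟨c, x, rfl⟩ p q h s ⟨h1, h2⟩
    exact ⟨h.trans h1, h2.trans_le (s.2 (show (⟨q, h⟩ : Set.Iic p) ≤ ⟨p, le_rfl⟩ from h))⟩
  continuous_proj := by
    refine @Continuous.mk _ _ (_) (_) _ fun W hW => ?_
    have e : (Sigma.fst ⁻¹' W : Set (Σ p : P, {s : Set.Iic p → ℝ // Antitone s})) =
        ⋃₀ {U | ∃ c ∈ W, ∃ x : ℝ, U = {z | z.1 ≤ c ∧ x < z.2.1 ⟨z.1, le_rfl⟩ }} := by
      ext z
      constructor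
      · intro hz
        obtain ⟨x, hx⟩ := exists_lt (z.2.1 ⟨z.1, le_rfl⟩)
        exact ⟨_, ⟨z.1, hz, x, rfl⟩, le_rfl, hx⟩
      · rintro ⟨_, ⟨c, hc, x, rfl⟩, h, -⟩
        exact hW h hc
    have h2 := TopologicalSpace.GenerateOpen.sUnion (g :=
      {U : Set (Σ p : P, {s : Set.Iic p → ℝ // Antitone s}) | ∃ (c : P) (x : ℝ),
        U = {z | z.1 ≤ c ∧ x < z.2.1 ⟨z.1, le_rfl⟩ }})
      {U | ∃ c ∈ W, ∃ x : ℝ, U = {z | z.1 ≤ c ∧ x < z.2.1 ⟨z.1, le_rfl⟩ }}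
      (by
        rintro _ ⟨c, -, x, rfl⟩
        exact .basic _ ⟨c, x, rfl⟩)
    rw [← e] at h2
    exact h2

/-- The continuous map from the inverse image of the lower reals along `f` to the lower reals:
`s ↦ s ∘ f` restricted to `↓p`. -/
def lowerRealsMap (f : P →o Q) : (inverseImage f).obj (lowerReals Q) ⟶ lowerReals P where
  toNatTrans :=
    { app := fun p => TypeCat.ofHom fun s =>
        ⟨fun d => s.1 ⟨f d.1, f.monotone d.2⟩, fun _ _ h => s.2 (f.monotone h)⟩ }
  continuous := by
    refine @continuous_generateFrom_iff _ _ (_) _ _ |>.2 ?_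
    rintro _ ⟨c, x, rfl⟩
    have h1 : IsOpen[((inverseImage f).obj (lowerReals Q)).topology]
        (Sigma.fst ⁻¹' (Set.Iic c)) :=
      @IsOpen.preimage _ _ (_) (_) _ ((inverseImage f).obj (lowerReals Q)).continuous_proj _
        (isLowerSet_Iic c)
    have h2 : IsOpen[((inverseImage f).obj (lowerReals Q)).topology]
        (baseChange f (lowerReals Q).sheaf ⁻¹' (⋃ e : Q, {z | z.1 ≤ e ∧ x < z.2.1 ⟨z.1, le_rfl⟩ })) := by
      have : ((inverseImage f).obj (lowerReals Q)).topology ≤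
        TopologicalSpace.induced (baseChange f (lowerReals Q).sheaf) (lowerReals Q).topology := inf_le_right
      refine this _ ⟨_, ?_, rfl⟩
      refine @isOpen_iUnion _ _ (_) _ fun e => ?_
      exact .basic _ ⟨e, x, rfl⟩
    convert @IsOpen.inter _ _ _ (_) h1 h2 using 1
    ext z
    constructor
    · rintro ⟨h3, h4⟩
      exact ⟨h3, Set.mem_iUnion.2 ⟨f z.1, le_rfl, h4⟩⟩
    · rintro ⟨h3, h4⟩
      obtain ⟨e, -, h5⟩ := Set.mem_iUnion.1 h4
      exact ⟨h3, h5⟩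

/-- The internal space of upper reals in `[Pᵒᵖ, Set]`: the presheaf of order-preserving functions
`↓p → ℝ`, with the topology generated by the sets `{(d, s) | d ≤ c, s(d) < x}`. -/
def upperReals (P : Type u) [Preorder P] : InternalSpace P where
  sheaf :=
    { obj := fun p => {s : Set.Iic p.unop → ℝ // Monotone s}
      map := fun i => TypeCat.ofHom fun s =>
        ⟨fun d => s.1 ⟨d.1, d.2.trans (leOfHom i.unop)⟩, fun _ _ h => s.2 h⟩ }
  topology := TopologicalSpace.generateFrom
    {U | ∃ (c : P) (x : ℝ), U = {z | z.1 ≤ c ∧ z.2.1 ⟨z.1, le_rfl⟩ < x }}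
  etale_le := by
    refine le_generateFrom ?_
    rintro _ ⟨c, x, rfl⟩ p q h s ⟨h1, h2⟩
    exact ⟨h.trans h1, (s.2 (show (⟨q, h⟩ : Set.Iic p) ≤ ⟨p, le_rfl⟩ from h)).trans_lt h2⟩
  continuous_proj := by
    refine @Continuous.mk _ _ (_) (_) _ fun W hW => ?_
    have e : (Sigma.fst ⁻¹' W : Set (Σ p : P, {s : Set.Iic p → ℝ // Monotone s})) =
        ⋃₀ {U | ∃ c ∈ W, ∃ x : ℝ, U = {z | z.1 ≤ c ∧ z.2.1 ⟨z.1, le_rfl⟩ < x }} := by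
      ext z
      constructor
      · intro hz
        obtain ⟨x, hx⟩ := exists_gt (z.2.1 ⟨z.1, le_rfl⟩)
        exact ⟨_, ⟨z.1, hz, x, rfl⟩, le_rfl, hx⟩
      · rintro ⟨_, ⟨c, hc, x, rfl⟩, h, -⟩
        exact hW h hc
    have h2 := TopologicalSpace.GenerateOpen.sUnion (g :=
      {U : Set (Σ p : P, {s : Set.Iic p → ℝ // Monotone s}) | ∃ (c : P) (x : ℝ),
        U = {z | z.1 ≤ c ∧ z.2.1 ⟨z.1, le_rfl⟩ < x }})
      {U | ∃ c ∈ W, ∃ x : ℝ, U = {z | z.1 ≤ c ∧ z.2.1 ⟨z.1, le_rfl⟩ < x }}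
      (by
        rintro _ ⟨c, -, x, rfl⟩
        exact .basic _ ⟨c, x, rfl⟩)
    rw [← e] at h2
    exact h2

/-- The continuous map from the inverse image of the upper reals along `f` to the upper reals:
`s ↦ s ∘ f` restricted to `↓p`. -/
def upperRealsMap (f : P →o Q) : (inverseImage f).obj (upperReals Q) ⟶ upperReals P where
  toNatTrans :=
    { app := fun p => TypeCat.ofHom fun s =>
        ⟨fun d => s.1 ⟨f d.1, f.monotone d.2⟩, fun _ _ h => s.2 (f.monotone h)⟩ }
  continuous := by
    refine @continuous_generateFrom_iff _ _ (_) _ _ |>.2 ?_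
    rintro _ ⟨c, x, rfl⟩
    have h1 : IsOpen[((inverseImage f).obj (upperReals Q)).topology]
        (Sigma.fst ⁻¹' (Set.Iic c)) :=
      @IsOpen.preimage _ _ (_) (_) _ ((inverseImage f).obj (upperReals Q)).continuous_proj _
        (isLowerSet_Iic c)
    have h2 : IsOpen[((inverseImage f).obj (upperReals Q)).topology]
        (baseChange f (upperReals Q).sheaf ⁻¹' (⋃ e : Q, {z | z.1 ≤ e ∧ z.2.1 ⟨z.1, le_rfl⟩ < x })) := by
      have : ((inverseImage f).obj (upperReals Q)).topology ≤
        TopologicalSpace.induced (baseChange f (upperReals Q).sheaf) (upperReals Q).topology := inf_le_right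
      refine this _ ⟨_, ?_, rfl⟩
      refine @isOpen_iUnion _ _ (_) _ fun e => ?_
      exact .basic _ ⟨e, x, rfl⟩
    convert @IsOpen.inter _ _ _ (_) h1 h2 using 1
    ext z
    constructor
    · rintro ⟨h3, h4⟩
      exact ⟨h3, Set.mem_iUnion.2 ⟨f z.1, le_rfl, h4⟩⟩
    · rintro ⟨h3, h4⟩
      obtain ⟨e, -, h5⟩ := Set.mem_iUnion.1 h4
      exact ⟨h3, h5⟩

end InternalSpaces

/-! ## The spectral presheaf and the daseinisation maps -/

section Spectral
variable {A : Type u} [CStarAlgebra A] [WStarAlgebra A]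

/-- The Gelfand spectrum of a context. -/
abbrev Context.Spectrum (C : Context A) : Type u := WeakDual.characterSpace ℂ C.alg

/-- The inclusion of contexts. -/
def Context.incl {D C : Context A} (h : D ≤ C) : D.alg →⋆ₐ[ℂ] C.alg := StarSubalgebra.inclusion h

/-- Restriction of characters, from the spectrum of `C` to that of a smaller context `D`. -/
noncomputable def Context.rho {D C : Context A} (h : D ≤ C) : C(C.Spectrum, D.Spectrum) :=
  WeakDual.CharacterSpace.compContinuousMap (Context.incl h)

/-- The spectral presheaf `C ↦ Σ_C`. -/
noncomputable def spectralPresheaf (A : Type u) [CStarAlgebra A] [WStarAlgebra A] :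
    (Context A)ᵒᵖ ⥤ Type u where
  obj C := C.unop.Spectrum
  map i := TypeCat.ofHom (Context.rho (leOfHom i.unop))


/-- The spectral presheaf as an internal space: `U` is open if it is closed under restriction and each
`U ∩ Σ_C` is open in `Σ_C`. -/
noncomputable def spectralSpace (A : Type u) [CStarAlgebra A] [WStarAlgebra A] :
    InternalSpace (Context A) where
  sheaf := spectralPresheaf A
  topology :=
    { IsOpen := fun U => IsOpen[etaleTopology (spectralPresheaf A)] U ∧
        ∀ C : Context A, IsOpen {l : C.Spectrum | (⟨C, l⟩ : TotalSpace (spectralPresheaf A)) ∈ U}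
      isOpen_univ := ⟨(etaleTopology _).isOpen_univ, fun _ => isOpen_univ⟩
      isOpen_inter := fun _ _ hU hV => ⟨(etaleTopology _).isOpen_inter _ _ hU.1 hV.1,
        fun C => (hU.2 C).inter (hV.2 C)⟩
      isOpen_sUnion := fun S hS => ⟨(etaleTopology _).isOpen_sUnion S fun U hU => (hS U hU).1, fun C => by
        have e : {l : C.Spectrum | (⟨C, l⟩ : TotalSpace (spectralPresheaf A)) ∈ ⋃₀ S} =
            ⋃ U ∈ S, {l : C.Spectrum | (⟨C, l⟩ : TotalSpace (spectralPresheaf A)) ∈ U} := by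
          ext l; simp
        rw [e]
        exact isOpen_biUnion fun U hU => (hS U hU).2 C⟩ }
  etale_le := fun _ hU => hU.1
  continuous_proj := by
    refine @Continuous.mk _ _ (_) (_) _ fun W hW => ⟨fun p q h x hx => hW h hx, fun C => ?_⟩
    by_cases hC : C ∈ W
    · convert isOpen_univ
      ext; simpa using hC
    · convert isOpen_empty
      ext; simpa using hC

/-- The order-preserving map `C ↦ h[C]` of contexts induced by a *-automorphism `h`. -/
def Context.map (h : A ≃⋆ₐ[ℂ] A) : Context A →o Context A where
  toFun C :=
    { alg := C.alg.map (h : A →⋆ₐ[ℂ] A)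
      comm := by
        rintro _ ⟨x, hx, rfl⟩ _ ⟨y, hy, rfl⟩
        have := congrArg h (C.comm x hx y hy)
        simpa using this
      closed := by
        intro X _ _ _ φ
        let ψ : A ≃ₗᵢ[ℂ] A :=
          { h.symm.toAlgEquiv.toLinearEquiv with
            norm_map' := fun x => NonUnitalStarAlgHom.norm_map h.symm h.symm.injective x }
        convert C.closed X (φ.trans ψ) using 1
        ext f
        constructor
        · rintro ⟨x, hx, hxf⟩
          have hxf : h x = φ (WeakDual.toStrongDual f) := hxf
          change h.symm (φ (WeakDual.toStrongDual f)) ∈ C.alg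
          rw [← hxf]
          simpa using hx
        · intro hf
          exact ⟨h.symm (φ (WeakDual.toStrongDual f)), hf, h.apply_symm_apply _⟩ }
  monotone' := fun C D hCD => StarSubalgebra.map_mono hCD

/-- The restriction `C → h[C]` of `h`. -/
def Context.restrictHom (h : A ≃⋆ₐ[ℂ] A) (C : Context A) : C.alg →⋆ₐ[ℂ] (Context.map h C).alg where
  toFun x := ⟨h x, ⟨x, x.2, rfl⟩⟩
  map_one' := Subtype.ext (map_one h)
  map_mul' x y := Subtype.ext (map_mul h (x : A) y)
  map_zero' := Subtype.ext (map_zero h)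
  map_add' x y := Subtype.ext (map_add h (x : A) y)
  commutes' r := Subtype.ext (AlgHomClass.commutes h r)
  map_star' x := Subtype.ext (map_star h (x : A))

theorem Context.map_injective (h : A ≃⋆ₐ[ℂ] A) : Function.Injective (Context.map h) := by
  intro C D hCD
  have h1 : C.alg.map (h : A →⋆ₐ[ℂ] A) = D.alg.map (h : A →⋆ₐ[ℂ] A) := congrArg Context.alg hCD
  exact Context.alg_injective (StarSubalgebra.map_injective h.injective h1)

theorem Context.map_surjective (h : A ≃⋆ₐ[ℂ] A) : Function.Surjective (Context.map h) := by
  intro C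
  refine ⟨Context.map h.symm C, Context.alg_injective (SetLike.ext fun x => ?_)⟩
  constructor
  · rintro ⟨_, ⟨y, hy, rfl⟩, rfl⟩
    change h (h.symm y) ∈ C.alg
    simpa using hy
  · intro hx
    exact ⟨h.symm x, ⟨x, hx, rfl⟩, h.apply_symm_apply x⟩

/-- The continuous map `Σ(h) : H^* Σ ⟶ Σ`, whose component at `C` is `Σ_{h[C]} → Σ_C`,
`λ ↦ λ ∘ h|_C`. -/
noncomputable def spectralMap (h : A ≃⋆ₐ[ℂ] A) :
    (inverseImage (Context.map h)).obj (spectralSpace A) ⟶ spectralSpace A where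
  toNatTrans :=
    { app := fun C => TypeCat.ofHom
        (WeakDual.CharacterSpace.compContinuousMap (Context.restrictHom h C.unop))
      naturality := by
        intro C D i
        rfl }
  continuous := by
    refine @Continuous.mk _ _ (_) (_) _ fun U hU => ?_
    have hle : ((inverseImage (Context.map h)).obj (spectralSpace A)).topology ≤
        TopologicalSpace.induced (baseChange (Context.map h) (spectralSpace A).sheaf)
          (spectralSpace A).topology := inf_le_right
    refine hle _ ?_
    let g (C : Context A) : C((Context.map h C).Spectrum, C.Spectrum) :=
      WeakDual.CharacterSpace.compContinuousMap (Context.restrictHom h C)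
    let V : Set (TotalSpace (spectralPresheaf A)) :=
      {z | ∃ (C : Context A) (l : (Context.map h C).Spectrum), z = ⟨Context.map h C, l⟩ ∧
        (⟨C, g C l⟩ : TotalSpace (spectralPresheaf A)) ∈ U}
    have key : ∀ (C : Context A) (l : (Context.map h C).Spectrum),
        (⟨Context.map h C, l⟩ : TotalSpace (spectralPresheaf A)) ∈ V ↔
        (⟨C, g C l⟩ : TotalSpace (spectralPresheaf A)) ∈ U := by
      intro C l
      constructor
      · rintro ⟨C', l', e, h'⟩
        have e1 : C = C' := Context.map_injective h (congrArg Sigma.fst e)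
        subst e1
        have e2 : l = l' := eq_of_heq (Sigma.mk.inj e).2
        subst e2
        exact h'
      · intro h'
        exact ⟨C, l, rfl, h'⟩
    refine ⟨V, ⟨?_, ?_⟩, ?_⟩
    · intro p q hqp l hl
      obtain ⟨C, rfl⟩ := Context.map_surjective h p
      obtain ⟨D, rfl⟩ := Context.map_surjective h q
      have hDC : D ≤ C := by
        intro x hx
        obtain ⟨y, hy, hyx⟩ := hqp (show h x ∈ (Context.map h D).alg from ⟨x, hx, rfl⟩)
        have : y = x := h.injective hyx
        exact this ▸ hy
      have h3 : (⟨D, Context.rho hDC (g C l)⟩ : TotalSpace (spectralPresheaf A)) ∈ U :=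
        hU.1 C D hDC (g C l) ((key C l).1 hl)
      have h4 : g D (Context.rho hqp l) = Context.rho hDC (g C l) := rfl
      rw [← h4] at h3
      exact (key D (Context.rho hqp l)).2 h3
    · intro p
      obtain ⟨C, rfl⟩ := Context.map_surjective h p
      simp only [key]
      exact (hU.2 C).preimage (g C).continuous
    · ext z
      exact key z.1 z.2

variable [PartialOrder A] [StarOrderedRing A]

/-- The (real) value `⟨λ, b⟩` of a character of `C` at a self-adjoint element of a smaller context. -/
noncomputable def Context.value {C : Context A} (l : C.Spectrum) {D : Context A} (h : D ≤ C)
    (b : D.SelfAdjoint) : ℝ := (l ⟨b, h b.2.1⟩).re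

theorem Context.character_mono {C : Context A} (l : C.Spectrum) {x y : A} (hx : x ∈ C.alg)
    (hy : y ∈ C.alg) (h : x ≤ y) : (l ⟨x, hx⟩).re ≤ (l ⟨y, hy⟩).re := by
  have h0 : 0 ≤ y - x := sub_nonneg.2 h
  have hs : cfc Real.sqrt (y - x) ∈ C.alg :=
    cfc_mem (𝕜 := ℝ) (𝕜' := ℂ) (s := C.alg) _ (sub_mem hy hx)
  have h1 : cfc Real.sqrt (y - x) * cfc Real.sqrt (y - x) = y - x := by
    rw [← cfc_mul Real.sqrt Real.sqrt (y - x)]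
    conv_rhs => rw [← cfc_id' ℝ (y - x)]
    exact cfc_congr fun t ht => Real.mul_self_sqrt (spectrum_nonneg_of_nonneg h0 ht)
  set s : C.alg := ⟨cfc Real.sqrt (y - x), hs⟩ with hsdef
  have h2 : star s = s := Subtype.ext (cfc_predicate Real.sqrt (y - x) : IsSelfAdjoint _)
  have h3 : (⟨y, hy⟩ : C.alg) = ⟨x, hx⟩ + star s * s := by
    rw [h2]
    refine Subtype.ext ?_
    change y = x + cfc Real.sqrt (y - x) * cfc Real.sqrt (y - x)
    rw [h1]; abel
  have h4 : star (l s) = l s := by rw [← map_star, h2]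
  have h5 : (l s).im = 0 := Complex.conj_eq_iff_im.1 h4
  rw [h3, map_add, map_mul, h2, Complex.add_re, Complex.mul_re, h5]
  nlinarith [mul_self_nonneg (l s).re]

/-- The continuous map `δᵒ(a) : Σ ⟶ R_l`, `δᵒ(a)_C(λ)(D) = ⟨λ, δᵒ(a)_D⟩` for `λ ∈ Σ_C`, `D ≤ C`. -/
noncomputable def outerDasMap (a : A) (ha : IsSelfAdjoint a) :
    spectralSpace A ⟶ lowerReals (Context A) where
  toNatTrans :=
    { app := fun C => TypeCat.ofHom fun l =>
        ⟨fun D => Context.value l D.2 (Context.outerDas ha D.1),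
          fun _ _ h => Context.character_mono l _ _ (Context.outerDas_anti ha h)⟩
      naturality := by
        intro C D i
        rfl }
  continuous := by
    refine @continuous_generateFrom_iff _ _ (_) _ _ |>.2 ?_
    rintro _ ⟨c, x, rfl⟩
    refine ⟨?_, fun C => ?_⟩
    · rintro C D h l ⟨h1, h2⟩
      exact ⟨h.trans h1, h2.trans_le
        (Context.character_mono l _ _ (Context.outerDas_anti ha h))⟩
    · by_cases hC : C ≤ c
      · have hcont : Continuous fun l : C.Spectrum => Context.value l le_rfl (Context.outerDas ha C) :=
          Complex.continuous_re.comp ((WeakDual.eval_continuous _).comp continuous_subtype_val)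
        convert (isOpen_lt continuous_const hcont : IsOpen {l : C.Spectrum | x < Context.value l le_rfl (Context.outerDas ha C)}) using 1
        ext l
        exact ⟨fun h => h.2, fun h => ⟨hC, h⟩⟩
      · convert isOpen_empty
        ext l
        exact ⟨fun h => hC h.1, fun h => h.elim⟩

/-- The continuous map `δⁱ(a) : Σ ⟶ R_u`, `δⁱ(a)_C(λ)(D) = ⟨λ, δⁱ(a)_D⟩` for `λ ∈ Σ_C`, `D ≤ C`. -/
noncomputable def innerDasMap (a : A) (ha : IsSelfAdjoint a) :
    spectralSpace A ⟶ upperReals (Context A) where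
  toNatTrans :=
    { app := fun C => TypeCat.ofHom fun l =>
        ⟨fun D => Context.value l D.2 (Context.innerDas ha D.1),
          fun _ _ h => Context.character_mono l _ _ (Context.innerDas_mono ha h)⟩
      naturality := by
        intro C D i
        rfl }
  continuous := by
    refine @continuous_generateFrom_iff _ _ (_) _ _ |>.2 ?_
    rintro _ ⟨c, x, rfl⟩
    refine ⟨?_, fun C => ?_⟩
    · rintro C D h l ⟨h1, h2⟩
      exact ⟨h.trans h1, LE.le.trans_lt
        (Context.character_mono l _ _ (Context.innerDas_mono ha h)) h2⟩
    · by_cases hC : C ≤ c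
      · have hcont : Continuous fun l : C.Spectrum => Context.value l le_rfl (Context.innerDas ha C) :=
          Complex.continuous_re.comp ((WeakDual.eval_continuous _).comp continuous_subtype_val)
        convert (isOpen_lt hcont continuous_const : IsOpen {l : C.Spectrum | Context.value l le_rfl (Context.innerDas ha C) < x}) using 1
        ext l
        exact ⟨fun h => h.2, fun h => ⟨hC, h⟩⟩
      · convert isOpen_empty
        ext l
        exact ⟨fun h => hC h.1, fun h => h.elim⟩
end Spectral
end Daseinisation

namespace Daseinisation

/-! ### Transport of the functional calculus and the spectral order along an automorphism. -/

section Equivariance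

variable {A : Type*} [CStarAlgebra A] [PartialOrder A] [StarOrderedRing A]

/-! Daseinisation is built from `a` and `C` by constructions intrinsic to the *-algebra `A`, so an
automorphism `h`, which preserves all of that structure, carries the daseinisation of `a` at `C` to
that of `h a` at `h[C]`. The two squares express this identity after evaluation at characters.

The construction has three layers, and `h` passes through each. The positive part of `a - x` is a
continuous function of `a`, and *-homomorphisms commute with the functional calculus
(`map_subPosPart`). The spectral projection is the largest projection annihilated by that positive
part; since `h` is an order automorphism of `A` that maps projections to projections, it preserves
such a maximum (`map_spectralProj`). Hence `h` preserves and reflects the spectral order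
(`spectralLE_map_iff`). Finally, `h` restricts to an order isomorphism from `C_sa` onto `h[C]_sa`,
which transports the bounds defining daseinisation (`outerDas_map`, `innerDas_map`).

Evaluate the outer square at a context `C`, a character `l` of `h[C]` and some `D ≤ C`. One side is
the value of `l` at the daseinisation of `h a` at `h[D]`; the other is the value of `l ∘ h` at the
daseinisation of `a` at `D`. They agree because the first daseinisation is `h` applied to the
second. The inner square is the same with joins for meets. Continuity contributes nothing to the
equalities: it is a property of the maps, which are determined by their components. -/

theorem continuous_starAlgEquiv (h : A ≃⋆ₐ[ℂ] A) : Continuous h :=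
  (AddMonoidHomClass.isometry_of_norm h fun x =>
    NonUnitalStarAlgHom.norm_map h h.injective x).continuous

/-- The order of a star-ordered ring is determined by its algebraic structure through the elements
`star s * s`, so both `h` and its inverse are monotone. -/
theorem starAlgEquiv_le_iff (h : A ≃⋆ₐ[ℂ] A) {x y : A} : h x ≤ h y ↔ x ≤ y :=
  map_le_map_iff h

/-- A continuous *-homomorphism commutes with the continuous functional calculus. Continuity of `h`
is automatic, as an injective *-homomorphism of C*-algebras is isometric. The functional calculus is
over `ℝ`, whereas `h` is linear over `ℂ`; hence the explicit `S := ℂ`. -/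
theorem map_subPosPart (h : A ≃⋆ₐ[ℂ] A) {a : A} (ha : IsSelfAdjoint a) (x : ℝ) :
    h (subPosPart a x) = subPosPart (h a) x :=
  StarAlgHomClass.map_cfc (S := ℂ) h (fun t : ℝ => max (t - x) 0) a
    (by fun_prop) (continuous_starAlgEquiv h) ha (ha.map h)

variable [WStarAlgebra A]

/-- Spectral projections are equivariant under *-automorphisms. -/
theorem map_spectralProj (h : A ≃⋆ₐ[ℂ] A) {a : A} (ha : IsSelfAdjoint a) (x : ℝ) :
    h (spectralProj a x) = spectralProj (h a) x := by
  -- `spectralProj` is obtained by choice, so only its maximality is available. It suffices that `h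
  -- (spectralProj a x)` is also a greatest element of the set that defines `spectralProj (h a) x`.
  refine IsGreatest.unique (s := {p : A | IsStarProjection p ∧ subPosPart (h a) x * p = 0})
    ⟨⟨(spectralProj_isGreatest a x).1.1.map h, ?_⟩, ?_⟩ (spectralProj_isGreatest (h a) x)
  · rw [← map_subPosPart h ha, ← map_mul, (spectralProj_isGreatest a x).1.2, map_zero]
  · rintro p ⟨hp, hp0⟩
    -- A competitor `p` for `h a` is pulled back to the competitor `h.symm p` for `a`, where
    -- maximality is known.
    rw [← h.apply_symm_apply p, starAlgEquiv_le_iff]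
    -- That `h.symm p` is annihilated is checked after applying `h`, which turns the product back
    -- into `subPosPart (h a) x * p`.
    refine (spectralProj_isGreatest a x).2 ⟨hp.map h.symm, h.injective ?_⟩
    change h (subPosPart a x * h.symm p) = h 0
    rw [map_mul, h.apply_symm_apply, map_subPosPart h ha, hp0, map_zero]

/-- The comparison of spectral projections is transported separately for each real `x`, since `h`
leaves the parameter of the resolution unchanged. -/
theorem spectralLE_map_iff (h : A ≃⋆ₐ[ℂ] A) {a b : A} (ha : IsSelfAdjoint a)
    (hb : IsSelfAdjoint b) : SpectralLE (h a) (h b) ↔ SpectralLE a b := by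
  simp only [SpectralLE, ← map_spectralProj h ha, ← map_spectralProj h hb, starAlgEquiv_le_iff]

/-! ### Equivariance of daseinisation, context by context. -/

namespace Context

/-- The order isomorphism `C_sa ≃ h[C]_sa` induced by a *-automorphism `h`. -/
def mapSelfAdjoint (h : A ≃⋆ₐ[ℂ] A) (C : Context A) :
    C.SelfAdjoint ≃o (Context.map h C).SelfAdjoint where
  toFun b := ⟨h b, ⟨b, b.2.1, rfl⟩, b.2.2.map h⟩
  invFun b := ⟨h.symm b, by
    obtain ⟨_, ⟨y, hy, rfl⟩, -⟩ := b
    change h.symm (h y) ∈ C.alg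
    rwa [h.symm_apply_apply], b.2.2.map h.symm⟩
  left_inv b := Subtype.ext (h.symm_apply_apply b)
  right_inv b := Subtype.ext (h.apply_symm_apply b)
  map_rel_iff' := starAlgEquiv_le_iff h

/-- An order isomorphism preserves greatest lower bounds, and these are unique. The bound is taken
inside `C_sa`, not in `A`, which is why the isomorphism `mapSelfAdjoint` onto `h[C]_sa` is needed
and the monotonicity of `h` on `A` alone would not do. -/
theorem outerDas_map (h : A ≃⋆ₐ[ℂ] A) {a : A} (ha : IsSelfAdjoint a) (C : Context A) :
    outerDas (ha.map h) (Context.map h C) = mapSelfAdjoint h C (outerDas ha C) := by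
  refine (outerDas_isGLB (ha.map h) _).unique ?_
  convert (mapSelfAdjoint h C).isGLB_image'.2 (outerDas_isGLB ha C) using 1
  -- What remains is that the elements of `h[C]_sa` spectrally above `h a` are exactly the images of
  -- those of `C_sa` above `a`. Writing each element of `h[C]_sa` as `h c` reduces this to
  -- invariance of the spectral order.
  rw [OrderIso.image_eq_preimage_symm]
  ext b
  obtain ⟨c, rfl⟩ := (mapSelfAdjoint h C).surjective b
  rw [Set.mem_preimage, OrderIso.symm_apply_apply]
  exact spectralLE_map_iff h ha c.2.2

/-- Dual to the outer case: least upper bounds are transported, and the arguments of the spectral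
order change places. -/
theorem innerDas_map (h : A ≃⋆ₐ[ℂ] A) {a : A} (ha : IsSelfAdjoint a) (C : Context A) :
    innerDas (ha.map h) (Context.map h C) = mapSelfAdjoint h C (innerDas ha C) := by
  refine (innerDas_isLUB (ha.map h) _).unique ?_
  convert (mapSelfAdjoint h C).isLUB_image'.2 (innerDas_isLUB ha C) using 1
  rw [OrderIso.image_eq_preimage_symm]
  ext b
  obtain ⟨c, rfl⟩ := (mapSelfAdjoint h C).surjective b
  rw [Set.mem_preimage, OrderIso.symm_apply_apply]
  exact spectralLE_map_iff h c.2.2 ha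

/-- Evaluating a character `l` of `h[C]` at `h b` is evaluating `l ∘ h|_C` at `b`. -/
theorem value_mapSelfAdjoint (h : A ≃⋆ₐ[ℂ] A) {C D : Context A} (hDC : D ≤ C)
    (l : (Context.map h C).Spectrum) (b : D.SelfAdjoint) :
    value l ((Context.map h).monotone hDC) (mapSelfAdjoint h D b) =
      value (WeakDual.CharacterSpace.compContinuousMap (restrictHom h C) l) hDC b :=
  -- Both sides unfold to the real part of `l` at `h b`, viewed in `h[C]`; the two membership proofs
  -- are identified by proof irrelevance.
  rfl

end Context

end Equivariance

end Daseinisation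

/-! ### Commutativity of the two squares. -/

open CategoryTheory Daseinisation in
/-- For a *-automorphism `h` of a von Neumann algebra `A` and a self-adjoint `a`, the squares of
continuous maps of internal spaces for outer daseinisation (with the lower reals) and for inner
daseinisation (with the upper reals) commute. -/
theorem proposition5p17 {A : Type*} [CStarAlgebra A] [WStarAlgebra A]
    [PartialOrder A] [StarOrderedRing A]
    (h : A ≃⋆ₐ[ℂ] A) (a : A) (ha : IsSelfAdjoint a) :
    (inverseImage (Context.map h)).map (outerDasMap (h a) (ha.map h)) ≫
        lowerRealsMap (Context.map h) = spectralMap h ≫ outerDasMap a ha ∧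
    (inverseImage (Context.map h)).map (innerDasMap (h a) (ha.map h)) ≫
        upperRealsMap (Context.map h) = spectralMap h ≫ innerDasMap a ha := by
  constructor
  · refine InternalSpace.Hom.ext (NatTrans.ext (funext fun C =>
      ConcreteCategory.hom_ext _ _ fun l => Subtype.ext (funext fun D => ?_)))
    -- The inverse image uses the component of the daseinisation map at `h[C]`, and the map of lower
    -- reals evaluates the resulting function at `h[D]`.
    change Context.value l ((Context.map h).monotone D.2)
      (Context.outerDas (ha.map h) (Context.map h D.1)) = _
    rw [Context.outerDas_map]
    exact Context.value_mapSelfAdjoint h D.2 l _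
  · refine InternalSpace.Hom.ext (NatTrans.ext (funext fun C =>
      ConcreteCategory.hom_ext _ _ fun l => Subtype.ext (funext fun D => ?_)))
    -- The same unfolding, with the upper reals in place of the lower ones.
    change Context.value l ((Context.map h).monotone D.2)
      (Context.innerDas (ha.map h) (Context.map h D.1)) = _
    rw [Context.innerDas_map]
    exact Context.value_mapSelfAdjoint h D.2 l _
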